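/- Work in the field of exponential transseries $$\widehat g(\zeta)=\sum_{(\nu,n)\in\mathbb R\times\mathbb Z}a_{\nu,n}\,e^{-\nu\zeta}\zeta^{-n},\qquad a_{\nu,n}\in\mathbb C,$$ whose support $\{(\nu,n):a_{\nu,n}\neq0\}$ is well-ordered for the lexicographic order (generalized power series, with the monomials $e^{-\nu\zeta}\zeta^{-n}$ multiplied in the usual way). Such a series is \emph{infinitesimal} if its support consists of indices $(\nu,n)>(0,0)$. A \emph{complex Dulac series} is a transseries of the form $$\alpha\zeta+\beta+\sum_{i\ge1}P_i(\zeta)e^{-\alpha_i\zeta},\qquad \alpha>0,\ \beta\in\mathbb C,\ P_i\in\mathbb C[\zeta],$$ where $(\alpha_i)_{i\geq 1}$ is a strictly increasing sequence of positive real numbers tending to $+\infty$ and contained in a finitely generated sub-semigroup of $(\mathbb R_{>0},+)$. A \emph{parabolic complex exponential transseries} is a transseries $\widehat\varphi=\zeta+\widehat\eta$ with $\widehat\eta$ infinitesimal; equivalently $\widehat\varphi=\zeta+\sum_{\nu\ge0}e^{-\nu\zeta}R_\nu(\zeta^{-1})$ with $R_\nu\in\mathbb C((X))$, $R_0\in X\mathbb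 C[[X]]$, and well-ordered support. If $\widehat f=\zeta+\beta+\widehat\varepsilon$ with $\beta\in\mathbb C$ and $\widehat\varepsilon$ infinitesimal, then the composition is $$\widehat\varphi\circ\widehat f:=\sum_{\nu,n}a_{\nu,n}\;e^{-\nu\beta}e^{-\nu\zeta}\Big(\sum_{k\ge0}\frac{(-\nu\widehat\varepsilon)^k}{k!}\Big)\widehat f^{\,-n}\qquad\text{for}\quad\widehat\varphi=\sum_{\nu,n}a_{\nu,n}e^{-\nu\zeta}\zeta^{-n}$$ (a well-defined sum of a summable family). \textbf{Lemma.} Let $\widehat f=\zeta+\beta+\sum_{i\ge1}P_i(\zeta)e^{-\alpha_i\zeta}$ be a complex Dulac series with leading coefficient $\alpha=1$ and $\operatorname{Re}\beta>0$. Then there exists a unique parabolic complex exponential transseries $\widehat\varphi$ such that $$\widehat\varphi\circ\widehat f=\widehat\varphi+\beta .$$ Moreover, $\widehat\varphi$ is a complex Dulac series, of the form $\zeta+\sum_{i\ge1}Q_i(\zeta)e^{-\beta_i\zeta}$ with $Q_i\in\mathbb C[\zeta]$ and $(\beta_i)_{i\ge1}$ a strictly increasing sequence of positive real numbers tending to $+\infty$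 and contained in a finitely generated sub-semigroup of $(\mathbb R_{>0},+)$. Finally, if all coefficients of $\widehat f$ are real, then all coefficients of $\widehat\varphi$ are real. -/

import Mathlib

/-- The field of exponential transseries with complex coefficients in the infinite variable `ζ`:
generalized series `∑ a_{ν,n} e^{-νζ} ζ^{-n}` whose support, a set of pairs `(ν, n)` in `ℝ × ℤ`,
is well-ordered for the lexicographic order.  The index `(ν, n)` stands for the monomial
`e^{-νζ} ζ^{-n}`; larger indices are asymptotically smaller monomials.  For fixed `ν` the terms
`e^{-νζ} ζ^{-n}` form a block `e^{-νζ} P_ν(ζ⁻¹)` with `P_ν` a Laurent series. -/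
abbrev ExpTransseries : Type := HahnSeries (ℝ ×ₗ ℤ) ℂ

namespace ExpTransseries

noncomputable section

/-- The monomial `e^{-νζ} ζ^{-n}`. -/
def mono (ν : ℝ) (n : ℤ) : ExpTransseries := HahnSeries.single (toLex (ν, n)) 1

/-- The variable `ζ`. -/
def zeta : ExpTransseries := mono 0 (-1)

/-- The constant term of a transseries. -/
def constTerm (f : ExpTransseries) : ℂ := f.coeff 0

/-- The remainder `f - ζ - β`, where `β` is the constant term of `f`. -/
def tail (f : ExpTransseries) : ExpTransseries := f - zeta - HahnSeries.C (constTerm f)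

/-- `f = ζ + β + ε` with a constant `β` and an infinitesimal transseries `ε` (all monomials of
`ε` are strictly smaller than `1`). -/
def IsNearTranslation (f : ExpTransseries) : Prop := 0 < (tail f).orderTop

/-- The composition `(e^{-νζ} ζ^{-n}) ∘ f` for `f = ζ + β + ε`, that is
`e^{-νf} f^{-n} = e^{-νζ} e^{-νβ} exp(-νε) f^{-n}`; here `exp(-νε) = ∑ₖ (-νε)ᵏ / k!` is the value
of the exponential power series at an infinitesimal, and `f^{-n}` is a power in the field of
transseries. -/
def monoComp (f : ExpTransseries) (ν : ℝ) (n : ℤ) : ExpTransseries :=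
  mono ν 0 * HahnSeries.C (Complex.exp (-(ν : ℂ) * constTerm f)) *
    PowerSeries.heval (HahnSeries.C (-(ν : ℂ)) * tail f) (PowerSeries.exp ℂ) * f ^ (-n)

section Summability

open HahnSeries

variable (S : AddSubmonoid (ℝ ×ₗ ℤ))

lemma support_mul_mem {x y : ExpTransseries} (hx : x.support ⊆ S) (hy : y.support ⊆ S) :
    (x * y).support ⊆ S := by
  intro g hg
  obtain ⟨i, hi, j, hj, rfl⟩ := support_mul_subset hg
  exact S.add_mem (hx hi) (hy hj)

lemma support_one_mem : (1 : ExpTransseries).support ⊆ S := by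
  intro g hg
  have : g = 0 := by
    by_contra h
    exact hg (by simp [coeff_one, h])
  rw [this]; exact S.zero_mem

lemma support_pow_mem {x : ExpTransseries} (hx : x.support ⊆ S) (n : ℕ) :
    (x ^ n).support ⊆ S := by
  induction n with
  | zero => rw [pow_zero]; exact support_one_mem S
  | succ n ih => rw [pow_succ]; exact support_mul_mem S ih hx

lemma support_powers_mem {x : ExpTransseries} (h : 0 < x.orderTop) (hx : x.support ⊆ S) :
    (SummableFamily.powers x).hsum.support ⊆ S := by
  intro g hg
  obtain ⟨n, hn⟩ := Set.mem_iUnion.1 (SummableFamily.support_hsum_subset hg)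
  rw [SummableFamily.powers_of_orderTop_pos h] at hn
  exact support_pow_mem S hx n hn

lemma support_neg_mem {x : ExpTransseries} (hx : x.support ⊆ S) : (-x).support ⊆ S := by
  intro g hg
  exact hx (by simpa using hg)

lemma support_one_add_zpow_mem {u : ExpTransseries} (h : 0 < u.orderTop) (hu : u.support ⊆ S)
    (n : ℤ) : ((1 + u) ^ n).support ⊆ S := by
  have h1 : (1 + u).support ⊆ S := by
    intro g hg
    rcases HahnSeries.support_add_subset (x := (1 : ExpTransseries)) (y := u) hg with hg | hg
    · exact support_one_mem S hg
    · exact hu hg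
  have h' : 0 < (-u).orderTop := by rwa [orderTop_neg]
  have h2 : ((1 + u)⁻¹).support ⊆ S := by
    have := SummableFamily.one_sub_self_mul_hsum_powers h'
    rw [sub_neg_eq_add] at this
    rw [← eq_inv_of_mul_eq_one_right this]
    exact support_powers_mem S h' (support_neg_mem S hu)
  cases n with
  | ofNat n => simpa using support_pow_mem S h1 n
  | negSucc n =>
    rw [zpow_negSucc, ← inv_pow]
    exact support_pow_mem S h2 _

lemma support_heval_mem {x : ExpTransseries} (hx : x.support ⊆ S) (p : PowerSeries ℂ)
    (h : 0 < x.orderTop) : (PowerSeries.heval x p).support ⊆ S := by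
  intro g hg
  obtain ⟨n, hn⟩ := Set.mem_iUnion.1 (SummableFamily.support_hsum_subset hg)
  rw [SummableFamily.powerSeriesFamily_of_orderTop_pos h] at hn
  refine support_pow_mem S hx n (fun h0 => hn ?_)
  simp [h0]

lemma pos_orderTop {x : ExpTransseries} (h : ∀ g ∈ x.support, 0 < g) : 0 < x.orderTop := by
  by_cases hx : x = 0
  · simp [hx]
  · rw [zero_lt_orderTop_iff hx]
    exact h _ (coeff_order_eq_zero.not.2 hx)

lemma pos_of_mem_support {x : ExpTransseries} (h : 0 < x.orderTop) {g : ℝ ×ₗ ℤ}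
    (hg : g ∈ x.support) : 0 < g := by
  exact_mod_cast lt_of_lt_of_le h (orderTop_le_of_coeff_ne_zero hg)

/-- The relative perturbation `u = f / ζ - 1`. -/
def relTail (f : ExpTransseries) : ExpTransseries := f * mono 0 1 - 1

lemma zeta_mul : zeta * mono 0 1 = 1 := by
  simp only [zeta, mono, single_mul_single]
  rw [← toLex_add]
  simp
  rfl

lemma zeta_eq_inv : zeta = (mono 0 1)⁻¹ := eq_inv_of_mul_eq_one_left zeta_mul

lemma relTail_pos {f : ExpTransseries} (hf : IsNearTranslation f) :
    0 < (relTail f).orderTop := by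
  apply pos_orderTop
  have e : relTail f = (tail f + C (constTerm f)) * mono 0 1 := by
    rw [tail, sub_add_cancel, sub_mul, zeta_mul, relTail]
  intro g hg
  rw [e] at hg
  obtain ⟨i, hi, j, hj, rfl⟩ := support_mul_subset hg
  have hj' : j = toLex ((0 : ℝ), (1 : ℤ)) := by
    by_contra h
    exact hj (coeff_single_of_ne h)
  have hj0 : 0 < j := by
    rw [hj']
    exact Prod.Lex.toLex_lt_toLex.2 (Or.inr ⟨rfl, by norm_num⟩)
  have hi0 : 0 ≤ i := by
    by_cases h : (tail f).coeff i = 0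
    · by_contra h0
      apply hi
      have : i ≠ 0 := fun h1 => h0 (h1 ▸ le_rfl)
      simp [h, C_apply, coeff_single_of_ne this]
    · exact (pos_of_mem_support hf h).le
  exact add_pos_of_nonneg_of_pos hi0 hj0

lemma eq_zeta_mul (f : ExpTransseries) : f = zeta * (1 + relTail f) := by
  have h := zeta_mul
  rw [relTail, add_sub_cancel, mul_comm f, ← mul_assoc, h, one_mul]

/-- The additive monoid generated by the supports of the two perturbations of `f`. -/
def suppMonoid (f : ExpTransseries) : AddSubmonoid (ℝ ×ₗ ℤ) :=
  AddSubmonoid.closure ((tail f).support ∪ (relTail f).support)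

lemma suppMonoid_isPWO {f : ExpTransseries} (hf : IsNearTranslation f) :
    (suppMonoid f : Set (ℝ ×ₗ ℤ)).IsPWO := by
  refine Set.IsPWO.addSubmonoid_closure ?_ ((tail f).isPWO_support.union (relTail f).isPWO_support)
  rintro g (hg | hg)
  · exact (pos_of_mem_support hf hg).le
  · exact (pos_of_mem_support (relTail_pos hf) hg).le

lemma mono_mul (a b : ℝ) (m n : ℤ) : mono a m * mono b n = mono (a + b) (m + n) := by
  simp only [mono, single_mul_single, ← toLex_add, Prod.mk_add_mk, mul_one]

lemma mono_zero : mono 0 0 = 1 := rfl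

lemma mono_ne_zero (a : ℝ) (n : ℤ) : mono a n ≠ 0 := by simp [mono]

lemma mono_zpow (n : ℤ) : mono 0 1 ^ n = mono 0 n := by
  induction n using Int.induction_on with
  | zero => rw [zpow_zero, mono_zero]
  | succ n ih => rw [zpow_add_one₀ (mono_ne_zero 0 1), ih, mono_mul, add_zero]
  | pred n ih =>
    rw [zpow_sub_one₀ (mono_ne_zero 0 1), ih, ← zeta_eq_inv, zeta, mono_mul, add_zero]
    rfl

lemma support_monoComp {f : ExpTransseries} (hf : IsNearTranslation f) (ν : ℝ) (n : ℤ)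
    {g : ℝ ×ₗ ℤ} (hg : g ∈ (monoComp f ν n).support) :
    ∃ b ∈ suppMonoid f, toLex (ν, n) + b = g := by
  have h1 : (tail f).support ⊆ suppMonoid f :=
    fun _ h => AddSubmonoid.subset_closure (Or.inl h)
  have h2 : (relTail f).support ⊆ suppMonoid f :=
    fun _ h => AddSubmonoid.subset_closure (Or.inr h)
  have h3 : (HahnSeries.C (-(ν : ℂ)) * tail f).support ⊆ (tail f).support := by
    intro m hm h
    exact hm (by rw [C_mul_eq_smul, coeff_smul, h, smul_zero])
  have e : monoComp f ν n = mono ν n * (C (Complex.exp (-(ν : ℂ) * constTerm f)) *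
      (PowerSeries.heval (HahnSeries.C (-(ν : ℂ)) * tail f) (PowerSeries.exp ℂ) *
        (1 + relTail f) ^ (-n))) := by
    have hfz : f ^ (-n) = mono 0 n * (1 + relTail f) ^ (-n) := by
      conv_lhs => rw [eq_zeta_mul f]
      rw [mul_zpow, zeta_eq_inv, inv_zpow', neg_neg, mono_zpow]
    have hm : mono ν n = mono ν 0 * mono 0 n := by rw [mono_mul, add_zero, zero_add]
    rw [monoComp, hfz, hm]
    ring
  rw [e] at hg
  obtain ⟨i, hi, j, hj, rfl⟩ := support_mul_subset hg
  have hi' : i = toLex (ν, n) := by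
    by_contra h
    exact hi (coeff_single_of_ne h)
  refine ⟨j, ?_, by rw [hi']⟩
  refine support_mul_mem _ ?_ (support_mul_mem _ (support_heval_mem _ (h3.trans h1) _ ?_)
    (support_one_add_zpow_mem _ (relTail_pos hf) h2 _)) hj
  · intro m hm
    have : m = 0 := by
      by_contra h
      exact hm (coeff_single_of_ne h)
    rw [this]
    exact (suppMonoid f).zero_mem
  · exact pos_orderTop fun m hm => pos_of_mem_support hf (h3 hm)

/-- The family of all terms `a_{ν,n} (e^{-νζ} ζ^{-n}) ∘ f`, where `φ = ∑ a_{ν,n} e^{-νζ} ζ^{-n}`.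
It is summable as soon as `f` is an infinitesimal perturbation of a translation. -/
def compFamily (φ f : ExpTransseries) (hf : IsNearTranslation f) :
    SummableFamily (ℝ ×ₗ ℤ) ℂ (ℝ ×ₗ ℤ) where
  toFun m := φ.coeff m • monoComp f (ofLex m).1 (ofLex m).2
  isPWO_iUnion_support' := by
    refine (φ.isPWO_support.add (suppMonoid_isPWO hf)).mono (Set.iUnion_subset fun m g hg => ?_)
    have hm : φ.coeff m ≠ 0 := fun h => hg (by simp [h])
    have hg' : g ∈ (monoComp f (ofLex m).1 (ofLex m).2).support := fun h => hg (by simp [h])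
    obtain ⟨b, hb, rfl⟩ := support_monoComp hf _ _ hg'
    exact ⟨m, hm, b, hb, rfl⟩
  finite_co_support' g := by
    refine (((Finset.antidiagonal φ.isPWO_support (suppMonoid_isPWO hf) g).finite_toSet).image
      Prod.fst).subset ?_
    intro m hg
    have hm : φ.coeff m ≠ 0 := fun h => hg (by simp [h])
    have hg' : g ∈ (monoComp f (ofLex m).1 (ofLex m).2).support := fun h => hg (by simp [h])
    obtain ⟨b, hb, h⟩ := support_monoComp hf _ _ hg'
    exact ⟨(m, b), Finset.mem_antidiagonal.2 ⟨hm, hb, h⟩, rfl⟩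

end Summability

/-- The composition `φ ∘ f` of transseries, for `f` an infinitesimal perturbation of a
translation: the sum of the terms `a_{ν,n} (e^{-νζ} ζ^{-n}) ∘ f`, where
`φ = ∑ a_{ν,n} e^{-νζ} ζ^{-n}`. -/
def comp (φ f : ExpTransseries) (hf : IsNearTranslation f) : ExpTransseries :=
  (compFamily φ f hf).hsum

/-- Parabolic exponential transseries: `φ = ζ + ε(ζ)` with `ε` infinitesimal. -/
def IsParabolic (φ : ExpTransseries) : Prop := 0 < (φ - zeta).orderTop

/-- `f = αζ + β + ∑ᵢ Pᵢ(ζ) e^{-aᵢζ}` is a complex Dulac series: `α > 0`, the `Pᵢ` are complex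
polynomials, and `(aᵢ)` is a strictly increasing sequence of positive reals tending to `+∞` whose
terms belong to a finitely generated sub-semigroup of `(ℝ_{>0}, +)`. -/
def IsDulacSeries (α : ℝ) (β : ℂ) (f : ExpTransseries) : Prop :=
  0 < α ∧ ∃ (a : ℕ → ℝ) (P : ℕ → Polynomial ℂ) (s : HahnSeries.SummableFamily (ℝ ×ₗ ℤ) ℂ ℕ),
    StrictMono a ∧ (∀ i, 0 < a i) ∧ Filter.Tendsto a Filter.atTop Filter.atTop ∧
    (∃ F : Finset ℝ, (∀ x ∈ F, 0 < x) ∧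
      ∀ i, a i ∈ AddSubsemigroup.closure (F : Set ℝ)) ∧
    (∀ i, s i = Polynomial.aeval zeta (P i) * mono (a i) 0) ∧
    f = HahnSeries.C (α : ℂ) * zeta + HahnSeries.C β + s.hsum

/-- All coefficients are real. -/
def HasRealCoeffs (f : ExpTransseries) : Prop := ∀ m, (f.coeff m).im = 0

lemma pos_of_mem_aeval {P : Polynomial ℂ} {a : ℝ} (ha : 0 < a) {g : ℝ ×ₗ ℤ}
    (hg : g ∈ (Polynomial.aeval zeta P * mono a 0).support) : 0 < g := by
  have key : ∀ h ∈ (Polynomial.aeval zeta P).support, (ofLex h).1 = 0 := by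
    let S : AddSubmonoid (ℝ ×ₗ ℤ) :=
      { carrier := {h | (ofLex h).1 = 0}
        zero_mem' := rfl
        add_mem' := fun {x y} hx hy => by
          change (ofLex x).1 + (ofLex y).1 = 0
          rw [show (ofLex x).1 = 0 from hx, show (ofLex y).1 = 0 from hy, add_zero] }
    have hzS : zeta.support ⊆ S := by
      intro h hh
      have : h = toLex ((0 : ℝ), (-1 : ℤ)) := by
        by_contra h'
        exact hh (HahnSeries.coeff_single_of_ne h')
      rw [this]
      rfl
    intro h hh
    rw [Polynomial.aeval_eq_sum_range, HahnSeries.mem_support, HahnSeries.coeff_sum] at hh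
    obtain ⟨i, -, hi⟩ := Finset.exists_ne_zero_of_sum_ne_zero hh
    refine support_pow_mem S hzS i (fun h0 => hi ?_)
    simp [h0]
  obtain ⟨i, hi, j, hj, rfl⟩ := HahnSeries.support_mul_subset hg
  have hj' : j = toLex (a, (0 : ℤ)) := by
    by_contra h
    exact hj (HahnSeries.coeff_single_of_ne h)
  have h1 : (ofLex (i + j)).1 = a := by
    rw [hj']
    change (ofLex i).1 + a = a
    rw [key i hi, zero_add]
  refine Prod.Lex.lt_iff.2 (Or.inl ?_)
  rw [h1]
  exact ha

/-- A Dulac series with `α = 1` is an infinitesimal perturbation of a translation. -/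
lemma IsDulacSeries.isNearTranslation {β : ℂ} {f : ExpTransseries} (hf : IsDulacSeries 1 β f) :
    IsNearTranslation f := by
  obtain ⟨-, a, P, s, -, ha, -, -, hs, rfl⟩ := hf
  have hz : ∀ g ∈ s.hsum.support, 0 < g := by
    intro g hg
    obtain ⟨i, hi⟩ := Set.mem_iUnion.1 (HahnSeries.SummableFamily.support_hsum_subset hg)
    rw [hs] at hi
    exact pos_of_mem_aeval (ha i) hi
  have h0 : s.hsum.coeff 0 = 0 := by
    by_contra h
    exact lt_irrefl _ (hz 0 h)
  have hzeta : zeta.coeff 0 = 0 := HahnSeries.coeff_single_of_ne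
    (fun h => by simpa using congrArg (fun x => (ofLex x).2) h)
  have e : tail (HahnSeries.C ((1 : ℝ) : ℂ) * zeta + HahnSeries.C β + s.hsum) = s.hsum := by
    have hc : constTerm (HahnSeries.C ((1 : ℝ) : ℂ) * zeta + HahnSeries.C β + s.hsum) = β := by
      simp [constTerm, h0, hzeta, -HahnSeries.SummableFamily.coeff_hsum]
    rw [tail, hc, Complex.ofReal_one, map_one, one_mul]
    ring
  rw [IsNearTranslation, e]
  exact pos_orderTop hz

end

end ExpTransseries

namespace ExpTransseries

open HahnSeries
open scoped Pointwise

/-! ### Constant and first-order coefficients -/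

/-! Put `φ = ζ + η`. Since `ζ ∘ f = f`, the equation `φ ∘ f = φ + β` becomes the linear equation `η
- η ∘ f = ε` with `ε = tail f`. Composing `e^{-νζ} ζ^{-n}` with `f` gives `e^{-νβ} e^{-νζ} ζ^{-n}`
plus strictly smaller monomials, so `η ↦ η - η ∘ f` is triangular with diagonal entries `1 -
e^{-νβ}`. For `ν > 0` these are nonzero, because `|e^{-νβ}| = e^{-ν Re β} < 1`.

Existence (`exists_sub_comp_eq`): every index of `ε` has `ν > 0`, and the system is solved by
recursion along a well-ordered set of indices with `ν > 0`.

Uniqueness (`eq_zero_of_comp_eq_self`): the difference `δ` of two solutions is infinitesimal with `δ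
∘ f = δ`. A leading index with `ν > 0` contradicts the diagonal entry. A leading term `ζ^{-n}`, `n >
0`, has zero diagonal entry, but `ζ^{-n} ∘ f` has coefficient `-nβ ≠ 0` at `ζ^{-n-1}`.

Dulac form and reality: any property of coefficients that survives the triangular recursion passes
from `ε` to `η`; a minimal counterexample is excluded by `coeff_sub_diag`. Applied to supports this
gives exponents in the monoid generated by those of `f` and nonnegative powers of `ζ`
(`support_subset_of_sub_comp`), and applied to imaginary parts it gives real coefficients
(`hasRealCoeffs_of_sub_comp`). -/

lemma eq_zero_or_eq_of_le_zeta_inv {i : ℝ ×ₗ ℤ} (h0 : 0 ≤ i) (h1 : i ≤ toLex ((0 : ℝ), (1 : ℤ))) :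
    i = 0 ∨ i = toLex ((0 : ℝ), (1 : ℤ)) := by
  obtain ⟨a, n⟩ := i
  have h0' : (0 : ℝ) < a ∨ (0 : ℝ) = a ∧ (0 : ℤ) ≤ n := Prod.Lex.toLex_le_toLex.1 h0
  have h1' : a < 0 ∨ a = 0 ∧ n ≤ 1 := Prod.Lex.toLex_le_toLex.1 h1
  have ha : a = 0 := by
    rcases h0' with h | h
    · rcases h1' with h' | h'
      · linarith
      · exact h'.1
    · exact h.1.symm
  subst ha
  have hn0 : 0 ≤ n := by simpa using h0'
  have hn1 : n ≤ 1 := by simpa using h1'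
  have : n = 0 ∨ n = 1 := by omega
  rcases this with rfl | rfl
  · exact Or.inl rfl
  · exact Or.inr rfl

lemma zeta_inv_index_pos : (0 : ℝ ×ₗ ℤ) < toLex ((0 : ℝ), (1 : ℤ)) :=
  Prod.Lex.toLex_lt_toLex.2 (Or.inr ⟨rfl, by norm_num⟩)

lemma coeff_mul_zero_of_nonneg {x y : ExpTransseries} (hx : ∀ g ∈ x.support, 0 ≤ g)
    (hy : ∀ g ∈ y.support, 0 ≤ g) : (x * y).coeff 0 = x.coeff 0 * y.coeff 0 := by
  rw [coeff_mul]
  rw [Finset.sum_subset (s₂ := {((0 : ℝ ×ₗ ℤ), (0 : ℝ ×ₗ ℤ))})]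
  · simp
  · rintro ⟨i, j⟩ hij
    obtain ⟨hi, hj, h⟩ := Finset.mem_antidiagonal.1 hij
    have h1 := hx i hi
    have h2 := hy j hj
    dsimp only at h
    have hi0 : i = 0 := le_antisymm (by rw [← h]; exact le_add_of_nonneg_right h2) h1
    subst hi0
    simpa using h
  · rintro ⟨i, j⟩ hij hn
    obtain ⟨rfl, rfl⟩ := Prod.mk.inj (Finset.mem_singleton.1 hij)
    by_contra h
    exact hn (Finset.mem_antidiagonal.2 ⟨left_ne_zero_of_mul h, right_ne_zero_of_mul h, add_zero _⟩)

/-- The index `(0, 1)` covers `0` in the lexicographic order, so among nonnegative indices it splits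
only as `0 + (0, 1)` and `(0, 1) + 0`. -/
lemma coeff_mul_one_of_nonneg {x y : ExpTransseries} (hx : ∀ g ∈ x.support, 0 ≤ g)
    (hy : ∀ g ∈ y.support, 0 ≤ g) :
    (x * y).coeff (toLex (0, 1)) =
      x.coeff 0 * y.coeff (toLex (0, 1)) + x.coeff (toLex (0, 1)) * y.coeff 0 := by
  have hne : ((0 : ℝ ×ₗ ℤ), toLex ((0 : ℝ), (1 : ℤ))) ≠ (toLex ((0 : ℝ), (1 : ℤ)), 0) :=
    fun h => zeta_inv_index_pos.ne (Prod.mk.inj h).1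
  rw [coeff_mul]
  rw [Finset.sum_subset (s₂ := {((0 : ℝ ×ₗ ℤ), toLex ((0 : ℝ), (1 : ℤ))),
    (toLex ((0 : ℝ), (1 : ℤ)), 0)})]
  · rw [Finset.sum_pair hne]
  · rintro ⟨i, j⟩ hij
    obtain ⟨hi, hj, h⟩ := Finset.mem_antidiagonal.1 hij
    have h1 := hx i hi
    have h2 := hy j hj
    dsimp only at h
    rw [Finset.mem_insert, Finset.mem_singleton]
    rcases eq_zero_or_eq_of_le_zeta_inv h1 (by rw [← h]; exact le_add_of_nonneg_right h2) with
      rfl | rfl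
    · left; simpa using h
    · right; simpa using h
  · rintro ⟨i, j⟩ hij hn
    by_contra h
    refine hn (Finset.mem_antidiagonal.2
      ⟨left_ne_zero_of_mul h, right_ne_zero_of_mul h, ?_⟩)
    rw [Finset.mem_insert, Finset.mem_singleton] at hij
    rcases hij with hij | hij <;> obtain ⟨rfl, rfl⟩ := Prod.mk.inj hij <;> simp

lemma coeff_zero_one_add_zpow {u : ExpTransseries} (hu : 0 < u.orderTop) (n : ℤ) :
    ((1 + u) ^ n).coeff 0 = 1 ∧
      ((1 + u) ^ n).coeff (toLex (0, 1)) = n * u.coeff (toLex (0, 1)) := by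
  have hS : ∀ k : ℤ, ∀ g ∈ ((1 + u) ^ k).support, 0 ≤ g := fun k g hg =>
    support_one_add_zpow_mem (AddSubmonoid.nonneg _) hu (fun g hg => (pos_of_mem_support hu hg).le) k hg
  have hu0 : u.coeff 0 = 0 := by
    by_contra h
    exact lt_irrefl _ (pos_of_mem_support hu (g := 0) h)
  have h10 : (1 + u).coeff 0 = 1 := by simp [hu0]
  have h11 : (1 + u).coeff (toLex (0, 1)) = u.coeff (toLex (0, 1)) := by
    simp [coeff_one, zeta_inv_index_pos.ne']
  have hS1 : ∀ g ∈ (1 + u).support, 0 ≤ g := by simpa using hS 1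
  have hne : 1 + u ≠ 0 := fun h => by simp [h] at h10
  -- Comparing both coefficients in `(1 + u)(1 + u)⁻¹ = 1` determines those of the inverse, as
  -- needed for the descending half of the induction.
  have hinv := coeff_mul_zero_of_nonneg hS1 (by simpa using hS (-1))
  have hinv' := coeff_mul_one_of_nonneg hS1 (by simpa using hS (-1))
  rw [mul_inv_cancel₀ hne, h10, one_mul, coeff_one, if_pos rfl] at hinv
  rw [mul_inv_cancel₀ hne, h10, h11, one_mul, coeff_one, if_neg zeta_inv_index_pos.ne',
    ← hinv, mul_one] at hinv'
  induction n using Int.induction_on with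
  | zero => simp [coeff_one, zeta_inv_index_pos.ne']
  | succ n ih =>
    rw [zpow_add_one₀ hne, coeff_mul_zero_of_nonneg (hS _) hS1,
      coeff_mul_one_of_nonneg (hS _) hS1, ih.1, ih.2, h10, h11]
    refine ⟨by ring, by push_cast; ring⟩
  | pred n ih =>
    have hSi : ∀ g ∈ ((1 + u)⁻¹).support, 0 ≤ g := by simpa using hS (-1)
    rw [zpow_sub_one₀ hne, coeff_mul_zero_of_nonneg (hS _) hSi,
      coeff_mul_one_of_nonneg (hS _) hSi, ih.1, ih.2, ← hinv]
    refine ⟨by ring, ?_⟩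
    push_cast
    linear_combination -hinv'

/-! ### The composition of a monomial -/

lemma coeff_mono_mul (ν : ℝ) (n : ℤ) (x : ExpTransseries) (g : ℝ ×ₗ ℤ) :
    (mono ν n * x).coeff (toLex (ν, n) + g) = x.coeff g := by
  rw [mono, add_comm, coeff_single_mul_add, one_mul]

lemma nonneg_of_mem_suppMonoid {f : ExpTransseries} (hf : IsNearTranslation f) {g : ℝ ×ₗ ℤ}
    (hg : g ∈ suppMonoid f) : 0 ≤ g := by
  have : suppMonoid f ≤ AddSubmonoid.nonneg (ℝ ×ₗ ℤ) := by
    refine AddSubmonoid.closure_le.2 ?_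
    rintro g (hg | hg)
    · exact (pos_of_mem_support hf hg).le
    · exact (pos_of_mem_support (relTail_pos hf) hg).le
  exact this hg

lemma le_of_mem_support_monoComp {f : ExpTransseries} (hf : IsNearTranslation f)
    {m g : ℝ ×ₗ ℤ} (hg : g ∈ (monoComp f (ofLex m).1 (ofLex m).2).support) : m ≤ g := by
  obtain ⟨b, hb, rfl⟩ := support_monoComp hf _ _ hg
  exact le_add_of_nonneg_right (nonneg_of_mem_suppMonoid hf hb)

lemma monoComp_eq (f : ExpTransseries) (ν : ℝ) (n : ℤ) :
    monoComp f ν n = mono ν n * (C (Complex.exp (-(ν : ℂ) * constTerm f)) *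
      (PowerSeries.heval (C (-(ν : ℂ)) * tail f) (PowerSeries.exp ℂ) *
        (1 + relTail f) ^ (-n))) := by
  have hfz : f ^ (-n) = mono 0 n * (1 + relTail f) ^ (-n) := by
    conv_lhs => rw [eq_zeta_mul f]
    rw [mul_zpow, zeta_eq_inv, inv_zpow', neg_neg, mono_zpow]
  have hm : mono ν n = mono ν 0 * mono 0 n := by rw [mono_mul, add_zero, zero_add]
  rw [monoComp, hfz, hm]
  ring

lemma C_mul_tail_orderTop_pos {f : ExpTransseries} (hf : IsNearTranslation f) (c : ℂ) :
    0 < (C c * tail f).orderTop := by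
  refine pos_orderTop fun m hm => pos_of_mem_support hf fun h => hm ?_
  rw [C_mul_eq_smul, coeff_smul, h, smul_zero]

/-- The diagonal entry: the exponential of an infinitesimal and the power of `1 + relTail f` both
have constant coefficient `1`, so only `e^{-νβ}` remains. -/
lemma coeff_monoComp_self {f : ExpTransseries} (hf : IsNearTranslation f) (m : ℝ ×ₗ ℤ) :
    (monoComp f (ofLex m).1 (ofLex m).2).coeff m =
      Complex.exp (-((ofLex m).1 : ℂ) * constTerm f) := by
  have h := coeff_mono_mul (ofLex m).1 (ofLex m).2 (C (Complex.exp (-((ofLex m).1 : ℂ) *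
    constTerm f)) * (PowerSeries.heval (C (-((ofLex m).1 : ℂ)) * tail f) (PowerSeries.exp ℂ) *
      (1 + relTail f) ^ (-(ofLex m).2))) 0
  rw [← monoComp_eq, add_zero] at h
  change (monoComp f (ofLex m).1 (ofLex m).2).coeff m = _ at h
  rw [h, C_mul_eq_smul, coeff_smul, coeff_mul_zero_of_nonneg,
    (coeff_zero_one_add_zpow (relTail_pos hf) _).1, PowerSeries.coeff_heval_zero]
  · simp
  · have hp := C_mul_tail_orderTop_pos hf (-((ofLex m).1 : ℂ))
    exact fun g hg => support_heval_mem (AddSubmonoid.nonneg _)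
      (fun g hg => (pos_of_mem_support hp hg).le) _ hp hg
  · exact fun g hg => support_one_add_zpow_mem (AddSubmonoid.nonneg _) (relTail_pos hf)
      (fun g hg => (pos_of_mem_support (relTail_pos hf) hg).le) _ hg

lemma heval_zero_exp : PowerSeries.heval (0 : ExpTransseries) (PowerSeries.exp ℂ) = 1 := by
  rw [PowerSeries.heval_apply, SummableFamily.powerSeriesFamily_hsum_zero]
  simp

lemma monoComp_zero_left (f : ExpTransseries) (n : ℤ) : monoComp f 0 n = f ^ (-n) := by
  simp only [monoComp, mono_zero, Complex.ofReal_zero, neg_zero, zero_mul, map_zero,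
    heval_zero_exp, Complex.exp_zero, map_one, one_mul]

lemma coeff_relTail {f : ExpTransseries} (hf : IsNearTranslation f) :
    (relTail f).coeff (toLex (0, 1)) = constTerm f := by
  have h0 : (tail f).coeff 0 = 0 := by
    by_contra h
    exact lt_irrefl _ (pos_of_mem_support hf (g := 0) h)
  have e : relTail f = mono 0 1 * (tail f + C (constTerm f)) := by
    rw [tail, sub_add_cancel, mul_sub, mul_comm _ zeta, zeta_mul, relTail, mul_comm]
  have := coeff_mono_mul 0 1 (tail f + C (constTerm f)) 0
  rw [← e, add_zero] at this
  rw [this, coeff_add, h0, zero_add]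
  simp

/-- The subdiagonal entry at `ν = 0`, read off from `f^{-n} = ζ^{-n} (1 + β ζ⁻¹ + ⋯)^{-n}`. It
replaces the diagonal one, which gives no information there. -/
lemma coeff_monoComp_succ {f : ExpTransseries} (hf : IsNearTranslation f) (n : ℤ) :
    (monoComp f 0 n).coeff (toLex (0, n + 1)) = -n * constTerm f := by
  have h := coeff_mono_mul 0 n ((1 + relTail f) ^ (-n)) (toLex (0, 1))
  rw [← toLex_add, Prod.mk_add_mk, add_zero, (coeff_zero_one_add_zpow (relTail_pos hf) _).2,
    coeff_relTail hf] at h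
  have e := monoComp_eq f 0 n
  simp only [Complex.ofReal_zero, neg_zero, zero_mul, map_zero,
    heval_zero_exp, Complex.exp_zero, map_one, one_mul] at e
  rw [e, h]
  push_cast
  ring

/-! ### Linearity of the composition -/

lemma coeff_comp (φ f : ExpTransseries) (hf : IsNearTranslation f) (g : ℝ ×ₗ ℤ) :
    (comp φ f hf).coeff g =
      ∑ᶠ m : ℝ ×ₗ ℤ, φ.coeff m * (monoComp f (ofLex m).1 (ofLex m).2).coeff g := by
  rw [comp, SummableFamily.coeff_hsum]
  rfl

lemma comp_add (φ ψ f : ExpTransseries) (hf : IsNearTranslation f) :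
    comp (φ + ψ) f hf = comp φ f hf + comp ψ f hf := by
  rw [comp, comp, comp, ← SummableFamily.hsum_add]
  congr 1
  ext m : 1
  exact add_smul _ _ _

lemma comp_neg (φ f : ExpTransseries) (hf : IsNearTranslation f) :
    comp (-φ) f hf = -comp φ f hf := by
  have h : comp 0 f hf = 0 := by
    ext g
    simp [coeff_comp]
  rw [eq_neg_iff_add_eq_zero, ← comp_add, neg_add_cancel, h]

lemma comp_zeta (f : ExpTransseries) (hf : IsNearTranslation f) : comp zeta f hf = f := by
  ext g
  rw [coeff_comp, finsum_eq_single _ (toLex ((0 : ℝ), (-1 : ℤ)))]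
  · have : monoComp f 0 (-1) = f := by simp [monoComp_zero_left]
    simp [zeta, mono, this]
  · intro m hm
    rw [zeta, mono, coeff_single_of_ne hm, zero_mul]

/-! ### Uniqueness -/

lemma exp_neg_mul_ne_one {β : ℂ} (hβ : 0 < β.re) {ν : ℝ} (hν : 0 < ν) :
    Complex.exp (-(ν : ℂ) * β) ≠ 1 := by
  intro h
  have := congrArg norm h
  rw [Complex.norm_exp, norm_one, Real.exp_eq_one_iff] at this
  simp at this
  rcases this with h | h <;> linarith

/-- Infinitesimality of `δ` matters: nonzero constants are also invariant under composition with
`f`. -/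
lemma eq_zero_of_comp_eq_self {f δ : ExpTransseries} (hf : IsNearTranslation f)
    (hβ : 0 < (constTerm f).re) (hδ : 0 < δ.orderTop) (h : comp δ f hf = δ) : δ = 0 := by
  by_contra hne
  obtain ⟨⟨ν, n⟩, hm⟩ : ∃ m : ℝ ×ₗ ℤ, m = δ.order := ⟨_, rfl⟩
  change toLex (ν, n) = δ.order at hm
  have ha : δ.coeff (toLex (ν, n)) ≠ 0 := by rw [hm]; exact coeff_order_eq_zero.not.2 hne
  have hle : ∀ g, δ.coeff g ≠ 0 → toLex (ν, n) ≤ g := fun g hg => by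
    rw [hm]; exact order_le_of_coeff_ne_zero hg
  have hpos : 0 < toLex (ν, n) := pos_of_mem_support hδ ha
  have hcases : (0 : ℝ) < ν ∨ (0 : ℝ) = ν ∧ (0 : ℤ) < n := Prod.Lex.toLex_lt_toLex.1 hpos
  rcases hcases with hν | ⟨rfl, hn⟩
  · have h1 := congrArg (fun x => x.coeff (toLex (ν, n))) h
    rw [coeff_comp, finsum_eq_single _ (toLex (ν, n)), coeff_monoComp_self hf] at h1
    · exact exp_neg_mul_ne_one hβ hν (mul_left_cancel₀ ha (h1.trans (mul_one _).symm))
    · intro m hm'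
      by_contra hc
      exact hm' (le_antisymm (le_of_mem_support_monoComp hf (right_ne_zero_of_mul hc))
        (hle m (left_ne_zero_of_mul hc)))
  -- For `ν = 0` the diagonal entry is `1`, so the comparison is made one index further. There the
  -- invariance reduces to `δ_{(0,n)} · (-nβ) = 0`.
  · have h1 := congrArg (fun x => x.coeff (toLex (0, n + 1))) h
    have hnn : toLex ((0 : ℝ), n) ≠ toLex ((0 : ℝ), n + 1) := fun h => by
      have := congrArg (fun x => (ofLex x).2) h
      simp at this
    rw [coeff_comp, finsum_eq_sum_of_support_subset
      (s := {toLex ((0 : ℝ), n), toLex ((0 : ℝ), n + 1)}), Finset.sum_pair hnn,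
      coeff_monoComp_self hf] at h1
    · have h2 : (monoComp f (ofLex (toLex ((0 : ℝ), n))).1 (ofLex (toLex ((0 : ℝ), n))).2).coeff
          (toLex (0, n + 1)) = -n * constTerm f := coeff_monoComp_succ hf n
      rw [h2] at h1
      simp only [ofLex_toLex, Complex.ofReal_zero, neg_zero, zero_mul, Complex.exp_zero,
        mul_one, add_eq_right, mul_eq_zero, neg_eq_zero, Int.cast_eq_zero] at h1
      rcases h1 with h1 | h1 | h1
      · exact ha h1
      · omega
      · simp [h1] at hβ
    -- A contributing index lies between `(0, n)` and `(0, n + 1)`, hence is one of the two.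
    · intro m hc
      have h1 := hle m (left_ne_zero_of_mul hc)
      have h2 := le_of_mem_support_monoComp hf (right_ne_zero_of_mul hc)
      have h3 := eq_zero_or_eq_of_le_zeta_inv (i := m - toLex (0, n)) (sub_nonneg.2 h1) (by
        rw [sub_le_iff_le_add, ← toLex_add, Prod.mk_add_mk, add_zero, add_comm 1 n]
        exact h2)
      rw [sub_eq_zero, sub_eq_iff_eq_add, ← toLex_add, Prod.mk_add_mk, add_zero, add_comm 1 n] at h3
      simpa using h3

/-! ### Existence -/

lemma zero_lt_of_fst_pos {g : ℝ ×ₗ ℤ} (h : 0 < (ofLex g).1) : 0 < g :=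
  Prod.Lex.lt_iff.2 (Or.inl h)

lemma fst_mono {g h : ℝ ×ₗ ℤ} (hgh : g ≤ h) : (ofLex g).1 ≤ (ofLex h).1 := by
  rcases Prod.Lex.le_iff.1 hgh with h | h
  · exact h.le
  · exact h.1.le

open Classical in
-- Solves the triangular system index by index. The condition `ν > 0` on the support of `ε` keeps
-- every diagonal entry met by the recursion invertible.
lemma exists_sub_comp_eq {f ε : ExpTransseries} (hf : IsNearTranslation f)
    (hβ : 0 < (constTerm f).re) (hε : ∀ g ∈ ε.support, 0 < (ofLex g).1) :
    ∃ η : ExpTransseries, (∀ g ∈ η.support, 0 < (ofLex g).1) ∧ η - comp η f hf = ε := by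
  -- `W` contains the support of `ε` and is stable under adding `suppMonoid f`, that is, under the
  -- indices created by composing with `f`. Being well-ordered, it serves both for the recursion and
  -- as a bound for the support of `η`.
  let W : Set (ℝ ×ₗ ℤ) := ε.support + (suppMonoid f : Set (ℝ ×ₗ ℤ))
  have hW : W.IsPWO := ε.isPWO_support.add (suppMonoid_isPWO hf)
  have hWpos : ∀ g ∈ W, 0 < (ofLex g).1 := by
    rintro _ ⟨e, he, b, hb, rfl⟩
    exact (hε e he).trans_le (fst_mono (le_add_of_nonneg_right (nonneg_of_mem_suppMonoid hf hb)))
  have hεW : ∀ g ∈ ε.support, g ∈ W := fun g hg =>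
    ⟨g, hg, 0, (suppMonoid f).zero_mem, add_zero g⟩
  have hwf : WellFounded fun a b : ℝ ×ₗ ℤ => a < b ∧ a ∈ W ∧ b ∈ W :=
    Set.wellFoundedOn_iff.1 hW.isWF
  let c : ℝ ×ₗ ℤ → ℝ ×ₗ ℤ → ℂ := fun m g => (monoComp f (ofLex m).1 (ofLex m).2).coeff g
  let q : ℝ ×ₗ ℤ → ℂ := fun g => 1 - Complex.exp (-((ofLex g).1 : ℂ) * constTerm f)
  -- The equation at `g` solved for the coefficient at `g`, with value `0` off `W`.
  let F : ∀ g : ℝ ×ₗ ℤ, (∀ m, (m < g ∧ m ∈ W ∧ g ∈ W) → ℂ) → ℂ := fun g rec =>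
    if g ∈ W then (q g)⁻¹ * (ε.coeff g +
      ∑ᶠ m : ℝ ×ₗ ℤ, if h : m < g ∧ m ∈ W ∧ g ∈ W then rec m h * c m g else 0) else 0
  let a : ℝ ×ₗ ℤ → ℂ := hwf.fix F
  have ha : ∀ g, a g = F g fun m _ => a m := fun g => hwf.fix_eq F g
  have hamem : ∀ g, a g ≠ 0 → g ∈ W := fun g hg => by
    by_contra h
    exact hg (by rw [ha]; exact if_neg h)
  have haW : ∀ g ∈ W, q g * a g =
      ε.coeff g + ∑ᶠ m : ℝ ×ₗ ℤ, if m < g then a m * c m g else 0 := fun g hg => by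
    have hq : q g ≠ 0 := sub_ne_zero.2 (exp_neg_mul_ne_one hβ (hWpos g hg)).symm
    rw [ha g]
    simp only [F, if_pos hg]
    rw [mul_inv_cancel_left₀ hq]
    congr 1
    refine finsum_congr fun m => ?_
    by_cases hm : m ∈ W
    · simp [hm, hg]
    · have : a m = 0 := by
        by_contra h
        exact hm (hamem m h)
      simp [this]
  let η : ExpTransseries := ⟨a, hW.mono hamem⟩
  refine ⟨η, fun g hg => hWpos g (hamem g hg), ?_⟩
  ext g
  rw [coeff_sub, coeff_comp]
  change a g - ∑ᶠ m, a m * c m g = ε.coeff g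
  have hfin : (Function.support fun m => a m * c m g).Finite := (compFamily η f hf).finite_co_support g
  by_cases hg : g ∈ W
  · have h1 := haW g hg
    -- Isolates the diagonal term; indices `m > g` contribute nothing, since composition never
    -- produces larger monomials.
    have h2 : ∀ m, a m * c m g = (if m < g then a m * c m g else 0) +
        (if m = g then a g * c g g else 0) := by
      intro m
      rcases lt_trichotomy m g with h | rfl | h
      · simp [h, h.ne]
      · simp
      · have : c m g = 0 := by
          by_contra h'
          exact absurd (le_of_mem_support_monoComp hf h') (not_le.2 h)
        simp [h.not_gt, h.ne', this]
    rw [finsum_congr h2, finsum_add_distrib, finsum_eq_single _ g (fun m hm => if_neg hm),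
      if_pos rfl, show c g g = _ from coeff_monoComp_self hf g]
    · simp only [q] at h1
      linear_combination h1
    · refine hfin.subset fun m hm => ?_
      by_cases h : m < g
      · simpa [h] using hm
      · simp [h] at hm
    · refine (Set.finite_singleton g).subset fun m hm => ?_
      by_contra h
      exact hm (if_neg h)
  -- Off `W` all terms vanish: a contribution to `g` from some `m ∈ W` would put `g` in `W` by
  -- stability.
  · have h1 : a g = 0 := by
      by_contra h
      exact hg (hamem g h)
    have h2 : ε.coeff g = 0 := by
      by_contra h
      exact hg (hεW g h)
    rw [h1, h2, finsum_eq_zero_of_forall_eq_zero, sub_zero]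
    intro m
    by_contra h
    obtain ⟨e, he, b, hb, hm⟩ := hamem m (left_ne_zero_of_mul h)
    obtain ⟨b', hb', rfl⟩ := support_monoComp hf _ _ (right_ne_zero_of_mul h)
    refine hg ⟨e, he, b + b', (suppMonoid f).add_mem hb hb', ?_⟩
    change e + (b + b') = m + b'
    rw [← hm, add_assoc]

/-- Triangularity of `η ↦ η - η ∘ f`: if the coefficient at `g` of the right hand side and the
contributions of all indices `m < g` lie in a subgroup of `ℂ`, then so does the diagonal term. -/
lemma coeff_sub_diag {f η ε : ExpTransseries} (hf : IsNearTranslation f)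
    (h : η - comp η f hf = ε) (g : ℝ ×ₗ ℤ) (A : AddSubgroup ℂ) (hε : ε.coeff g ∈ A)
    (hA : ∀ m < g, η.coeff m * (monoComp f (ofLex m).1 (ofLex m).2).coeff g ∈ A) :
    η.coeff g * (1 - Complex.exp (-((ofLex g).1 : ℂ) * constTerm f)) ∈ A := by
  have h1 := congrArg (fun x => x.coeff g) h
  have hfin : (Function.support fun m => η.coeff m *
    (monoComp f (ofLex m).1 (ofLex m).2).coeff g).Finite :=
      (compFamily η f hf).finite_co_support g
  rw [coeff_sub, coeff_comp, finsum_eq_sum_of_support_subset (s := insert g hfin.toFinset) _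
    (fun m hm => by simpa using Or.inr hm), ← Finset.add_sum_erase _ _ (Finset.mem_insert_self _ _),
    coeff_monoComp_self hf] at h1
  have h2 : η.coeff g * (1 - Complex.exp (-((ofLex g).1 : ℂ) * constTerm f)) =
      ε.coeff g + ∑ m ∈ (insert g hfin.toFinset).erase g,
        η.coeff m * (monoComp f (ofLex m).1 (ofLex m).2).coeff g := by
    linear_combination h1
  rw [h2]
  refine A.add_mem hε (A.sum_mem fun m hm => ?_)
  rcases lt_or_ge m g with h | h
  · exact hA m h
  · have : (monoComp f (ofLex m).1 (ofLex m).2).coeff g = 0 := by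
      by_contra h'
      exact Finset.ne_of_mem_erase hm (le_antisymm (le_of_mem_support_monoComp hf h') h)
    rw [this, mul_zero]
    exact A.zero_mem

/-! ### Control of the support of the solution -/

lemma exists_minimal_support {η : ExpTransseries} {p : ℝ ×ₗ ℤ → Prop}
    (h : ∃ g ∈ η.support, ¬ p g) :
    ∃ g ∈ η.support, ¬ p g ∧ ∀ m < g, m ∈ η.support → p m := by
  obtain ⟨g, hg, hp⟩ := h
  have hwf : ({g | g ∈ η.support ∧ ¬ p g}).IsWF := (η.isPWO_support.mono fun g hg => hg.1).isWF
  have hmem := hwf.min_mem ⟨g, hg, hp⟩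
  refine ⟨_, hmem.1, hmem.2, fun m hm hs => ?_⟩
  by_contra hpm
  exact hwf.not_lt_min ⟨_, hg, hp⟩ ⟨hs, hpm⟩ hm

/-- With `hM` the factor `f^{-n}` is a power with natural exponent, so no inverse of `f` enters and
negative powers of `ζ` are avoided. `hM'` accounts for the factor `e^{-νζ}`, which appears without
its power of `ζ`. -/
lemma support_monoComp_subset {f : ExpTransseries} (hf : IsNearTranslation f)
    {M : AddSubmonoid (ℝ ×ₗ ℤ)} (hM : ∀ g ∈ M, (ofLex g).2 ≤ 0)
    (hM' : ∀ g ∈ M, toLex ((ofLex g).1, (0 : ℤ)) ∈ M)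
    (hfM : f.support ⊆ M) (htM : (tail f).support ⊆ M) {m : ℝ ×ₗ ℤ} (hm : m ∈ M) :
    (monoComp f (ofLex m).1 (ofLex m).2).support ⊆ M := by
  have hsingle : ∀ g ∈ M, ∀ c : ℂ, (single g c : ExpTransseries).support ⊆ M := by
    intro g hg c k hk
    have : k = g := by
      by_contra h
      exact hk (coeff_single_of_ne h)
    rw [this]
    exact hg
  obtain ⟨k, hk⟩ := Int.eq_ofNat_of_zero_le (neg_nonneg.2 (hM m hm))
  rw [monoComp, hk, zpow_natCast]
  have hp := C_mul_tail_orderTop_pos hf (-((ofLex m).1 : ℂ))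
  refine support_mul_mem M (support_mul_mem M (support_mul_mem M (hsingle _ (hM' m hm) _)
    (hsingle 0 M.zero_mem _)) (support_heval_mem M ?_ _ hp)) (support_pow_mem M hfM k)
  exact support_mul_mem M (hsingle 0 M.zero_mem _) htM

lemma support_subset_of_sub_comp {f η ε : ExpTransseries} (hf : IsNearTranslation f)
    (hβ : 0 < (constTerm f).re) (h : η - comp η f hf = ε)
    (hη : ∀ g ∈ η.support, 0 < (ofLex g).1)
    {M : AddSubmonoid (ℝ ×ₗ ℤ)} (hM : ∀ g ∈ M, (ofLex g).2 ≤ 0)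
    (hM' : ∀ g ∈ M, toLex ((ofLex g).1, (0 : ℤ)) ∈ M)
    (hfM : f.support ⊆ M) (htM : (tail f).support ⊆ M) (hεM : ε.support ⊆ M) :
    η.support ⊆ M := by
  by_contra hc
  obtain ⟨g, hg, hgM, hmin⟩ := exists_minimal_support (p := (· ∈ M)) (Set.not_subset.1 hc)
  -- At a minimal `g ∉ M` nothing else contributes, so the trivial subgroup makes the diagonal term
  -- vanish.
  have := coeff_sub_diag hf h g ⊥ (by
    by_contra h
    exact hgM (hεM h)) (by
    intro m hm
    by_contra h
    exact hgM (support_monoComp_subset hf hM hM' hfM htM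
      (hmin m hm (left_ne_zero_of_mul h)) (right_ne_zero_of_mul h)))
  rcases mul_eq_zero.1 (AddSubgroup.mem_bot.1 this) with h | h
  · exact hg h
  · exact exp_neg_mul_ne_one hβ (hη g hg) (sub_eq_zero.1 h).symm

/-! ### Real coefficients -/

lemma HasRealCoeffs.mul {x y : ExpTransseries} (hx : HasRealCoeffs x) (hy : HasRealCoeffs y) :
    HasRealCoeffs (x * y) := by
  intro g
  rw [coeff_mul, Complex.im_sum]
  refine Finset.sum_eq_zero fun i _ => ?_
  rw [Complex.mul_im, hx, hy, mul_zero, zero_mul, add_zero]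

lemma hasRealCoeffs_single (g : ℝ ×ₗ ℤ) {c : ℂ} (hc : c.im = 0) :
    HasRealCoeffs (single g c) := by
  intro m
  by_cases h : m = g
  · simp [h, hc]
  · rw [coeff_single_of_ne h, Complex.zero_im]

lemma HasRealCoeffs.pow {x : ExpTransseries} (hx : HasRealCoeffs x) (n : ℕ) :
    HasRealCoeffs (x ^ n) := by
  induction n with
  | zero => exact hasRealCoeffs_single 0 Complex.one_im
  | succ n ih => rw [pow_succ]; exact ih.mul hx

lemma HasRealCoeffs.heval {x : ExpTransseries} (hx : HasRealCoeffs x) (h : 0 < x.orderTop)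
    {p : PowerSeries ℂ} (hp : ∀ n, (p.coeff n).im = 0) :
    HasRealCoeffs (PowerSeries.heval x p) := by
  intro g
  rw [PowerSeries.heval_apply, SummableFamily.coeff_hsum]
  refine finsum_induction (fun z : ℂ => z.im = 0) Complex.zero_im
    (fun a b ha hb => by rw [Complex.add_im, ha, hb, add_zero]) fun n => ?_
  rw [SummableFamily.powerSeriesFamily_of_orderTop_pos h, coeff_smul, smul_eq_mul, Complex.mul_im,
    hp, hx.pow n g, mul_zero, zero_mul, add_zero]

lemma HasRealCoeffs.sub {x y : ExpTransseries} (hx : HasRealCoeffs x) (hy : HasRealCoeffs y) :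
    HasRealCoeffs (x - y) := by
  intro g
  rw [coeff_sub, Complex.sub_im, hx, hy, sub_zero]

lemma HasRealCoeffs.add {x y : ExpTransseries} (hx : HasRealCoeffs x) (hy : HasRealCoeffs y) :
    HasRealCoeffs (x + y) := by
  intro g
  rw [coeff_add, Complex.add_im, hx, hy, add_zero]

lemma exp_neg_ofReal_mul_im {β : ℂ} (hβ : β.im = 0) (ν : ℝ) :
    (Complex.exp (-(ν : ℂ) * β)).im = 0 := by
  rw [Complex.exp_im]
  simp [hβ]

lemma HasRealCoeffs.tail {f : ExpTransseries} (hr : HasRealCoeffs f) : HasRealCoeffs (tail f) :=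
  (hr.sub (hasRealCoeffs_single _ Complex.one_im)).sub (hasRealCoeffs_single 0 (hr 0))

lemma HasRealCoeffs.monoComp {f : ExpTransseries} (hr : HasRealCoeffs f)
    (hf : IsNearTranslation f) (ν : ℝ) {n : ℤ} (hn : n ≤ 0) :
    HasRealCoeffs (monoComp f ν n) := by
  obtain ⟨k, hk⟩ := Int.eq_ofNat_of_zero_le (neg_nonneg.2 hn)
  rw [ExpTransseries.monoComp, hk, zpow_natCast]
  refine (((hasRealCoeffs_single _ Complex.one_im).mul (hasRealCoeffs_single 0
    (exp_neg_ofReal_mul_im (hr 0) ν))).mul (HasRealCoeffs.heval ((hasRealCoeffs_single 0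
      (by simp)).mul hr.tail) (C_mul_tail_orderTop_pos hf _) fun j => ?_)).mul (hr.pow k)
  rw [PowerSeries.coeff_exp]
  simp

lemma hasRealCoeffs_of_sub_comp {f η ε : ExpTransseries} (hf : IsNearTranslation f)
    (hβ : 0 < (constTerm f).re) (h : η - comp η f hf = ε)
    (hη : ∀ g ∈ η.support, 0 < (ofLex g).1) (hη' : ∀ g ∈ η.support, (ofLex g).2 ≤ 0)
    (hr : HasRealCoeffs f) (hε : HasRealCoeffs ε) : HasRealCoeffs η := by
  by_contra hc
  obtain ⟨g₀, hg₀⟩ := not_forall.1 hc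
  obtain ⟨g, hg, hgr, hmin⟩ := exists_minimal_support (η := η) (p := fun g => (η.coeff g).im = 0)
    ⟨g₀, fun h => hg₀ (by rw [h, Complex.zero_im]), hg₀⟩
  -- The subgroup is now the real line. The multiplier `1 - e^{-νβ}` is real and nonzero, so a real
  -- diagonal term forces a real coefficient.
  have hreal := coeff_sub_diag hf h g Complex.imAddGroupHom.ker (hε g) (by
    intro m hm
    change (_ * _ : ℂ).im = 0
    by_cases hs : m ∈ η.support
    · rw [Complex.mul_im, hmin m hm hs, (hr.monoComp hf _ (hη' m hs)) g, mul_zero, zero_mul,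
        add_zero]
    · rw [not_not.1 hs, zero_mul, Complex.zero_im])
  have hq := exp_neg_mul_ne_one hβ (hη g hg)
  have hqi := exp_neg_ofReal_mul_im (hr 0) (ofLex g).1
  change (_ * _ : ℂ).im = 0 at hreal
  rw [Complex.mul_im, Complex.sub_im, Complex.sub_re] at hreal
  change (Complex.exp (-((ofLex g).1 : ℂ) * constTerm f)).im = 0 at hqi
  rw [hqi, Complex.one_im, sub_zero, mul_zero, zero_add, mul_eq_zero, or_iff_right hgr,
    sub_eq_zero] at hreal
  exact hq (Complex.ext hreal.symm hqi)

/-! ### Dulac series -/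

/-- The support argument works with monoids, while Dulac series require a semigroup of positive
exponents; only the element `0` separates the two. -/
lemma mem_closure_of_mem_closure_of_ne_zero {A : Type*} [AddMonoid A] {F : Set A} {x : A}
    (hx : x ∈ AddSubmonoid.closure F) (h0 : x ≠ 0) : x ∈ AddSubsemigroup.closure F := by
  have : x = 0 ∨ x ∈ AddSubsemigroup.closure F := by
    clear h0
    induction hx using AddSubmonoid.closure_induction with
    | mem x hx => exact Or.inr (AddSubsemigroup.subset_closure hx)
    | zero => exact Or.inl rfl
    | add x y _ _ hx hy =>
      rcases hx with rfl | hx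
      · simpa using hy
      · rcases hy with rfl | hy
        · simpa using Or.inr hx
        · exact Or.inr (add_mem hx hy)
  exact this.resolve_left h0

lemma closure_le_addSubmonoid_closure {A : Type*} [AddMonoid A] {F : Set A} {x : A}
    (hx : x ∈ AddSubsemigroup.closure F) : x ∈ AddSubmonoid.closure F := by
  have : AddSubsemigroup.closure F ≤ (AddSubmonoid.closure F).toAddSubsemigroup :=
    AddSubsemigroup.closure_le.2 AddSubmonoid.subset_closure
  exact this hx

/-- A sum of `n` generators is at least `n · min F`, so only finitely many lengths `n` stay below
`c`. Here `n • F` is the `n`-fold sumset, which is finite. -/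
lemma finite_closure_inter_Iic {F : Finset ℝ} (hF : ∀ x ∈ F, 0 < x) (hne : F.Nonempty) (c : ℝ) :
    {x | x ∈ AddSubsemigroup.closure (F : Set ℝ) ∧ x ≤ c}.Finite := by
  have hm : 0 < F.min' hne := hF _ (F.min'_mem hne)
  have key : ∀ x ∈ AddSubsemigroup.closure (F : Set ℝ),
      ∃ n : ℕ, x ∈ n • (F : Set ℝ) ∧ n * F.min' hne ≤ x := by
    intro x hx
    induction hx using AddSubsemigroup.closure_induction with
    | mem x hx => exact ⟨1, by simpa using hx, by simpa using F.min'_le x hx⟩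
    | add x y _ _ hx hy =>
      obtain ⟨n, hn, hn'⟩ := hx
      obtain ⟨k, hk, hk'⟩ := hy
      refine ⟨n + k, ?_, by push_cast; linarith⟩
      rw [add_smul]
      exact Set.add_mem_add hn hk
  have hfin : ∀ n : ℕ, (n • (F : Set ℝ)).Finite := by
    intro n
    induction n with
    | zero => rw [zero_smul]; exact Set.finite_zero
    | succ n ih => rw [succ_nsmul]; exact ih.add F.finite_toSet
  refine ((Set.finite_Iic ⌊c / F.min' hne⌋₊).biUnion fun n _ => hfin n).subset ?_
  rintro x ⟨hx, hxc⟩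
  obtain ⟨n, hn, hn'⟩ := key x hx
  refine Set.mem_biUnion (x := n) ?_ hn
  exact Nat.le_floor ((le_div_iff₀ hm).2 (hn'.trans hxc))

/-- The elements of a finitely generated semigroup of positive reals form a strictly increasing
sequence tending to infinity. -/
lemma exists_enumeration_closure {F : Finset ℝ} (hF : ∀ x ∈ F, 0 < x) (hne : F.Nonempty) :
    ∃ a : ℕ → ℝ, StrictMono a ∧ Filter.Tendsto a Filter.atTop Filter.atTop ∧
      Set.range a = AddSubsemigroup.closure (F : Set ℝ) := by
  obtain ⟨x₀, hx₀⟩ := hne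
  let T : Set ℝ := {x | x ∈ AddSubsemigroup.closure (F : Set ℝ)}
  have hpos : ∀ x ∈ T, 0 < x := by
    intro x hx
    induction hx using AddSubsemigroup.closure_induction with
    | mem x hx => exact hF x hx
    | add x y _ _ hx hy => exact add_pos hx hy
  have hfin := finite_closure_inter_Iic hF ⟨x₀, hx₀⟩
  have hx₀T : x₀ ∈ T := AddSubsemigroup.subset_closure hx₀
  obtain ⟨b, ⟨hbT, hb₀⟩, hb⟩ := Set.exists_min_image _ id (hfin x₀) ⟨x₀, hx₀T, le_rfl⟩
  have hbot : ∀ x ∈ T, b ≤ x := fun x hx => by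
    rcases le_total x x₀ with h | h
    · exact hb x ⟨hx, h⟩
    · exact hb₀.trans h
  -- A nonempty, locally finite linear order with a least element and no greatest one is isomorphic
  -- to `ℕ`; doubling rules out a greatest element.
  let _ : LocallyFiniteOrder T := LocallyFiniteOrder.ofFiniteIcc fun x y =>
    Set.Finite.of_finite_image ((hfin y).subset (by
      rintro _ ⟨z, hz, rfl⟩
      exact ⟨z.2, hz.2⟩)) Subtype.val_injective.injOn
  let _ : OrderBot T := { bot := ⟨b, hbT⟩, bot_le := fun x => hbot x x.2 }
  have _ : Nonempty T := ⟨⊥⟩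
  have _ : NoMaxOrder T := ⟨fun x => ⟨⟨x + x, (AddSubsemigroup.closure (F : Set ℝ)).add_mem x.2 x.2⟩, by
    change (x : ℝ) < x + x
    linarith [hpos x x.2]⟩⟩
  let _ : SuccOrder T := LinearLocallyFiniteOrder.succOrder T
  let _ : PredOrder T := LinearLocallyFiniteOrder.predOrder T
  let e : T ≃o ℕ := orderIsoNatOfLinearSuccPredArch
  have hmono : StrictMono fun n => (e.symm n : ℝ) := fun m n h => e.symm.strictMono h
  have hrange : Set.range (fun n => (e.symm n : ℝ)) = T := by
    ext x
    constructor
    · rintro ⟨n, rfl⟩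
      exact (e.symm n).2
    · exact fun hx => ⟨e ⟨x, hx⟩, by simp⟩
  refine ⟨_, hmono, Filter.tendsto_atTop_atTop_of_monotone hmono.monotone fun c => ?_, hrange⟩
  -- A bounded enumeration would place an infinite range in the finite set of semigroup elements at
  -- most `c`.
  by_contra! h
  exact (Set.infinite_range_of_injective hmono.injective) ((hfin c).subset (by
    rintro _ ⟨n, rfl⟩
    exact ⟨(e.symm n).2, (h n).le⟩))

/-! ### Exponential blocks with polynomial coefficients -/

lemma support_aeval_mul_mono {P : Polynomial ℂ} {a : ℝ} {g : ℝ ×ₗ ℤ}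
    (hg : g ∈ (Polynomial.aeval zeta P * mono a 0).support) :
    (ofLex g).1 = a ∧ (ofLex g).2 ≤ 0 := by
  let S : AddSubmonoid (ℝ ×ₗ ℤ) :=
    { carrier := {h | (ofLex h).1 = 0 ∧ (ofLex h).2 ≤ 0}
      zero_mem' := ⟨rfl, le_rfl⟩
      add_mem' := fun {x y} hx hy => by
        refine ⟨?_, add_nonpos hx.2 hy.2⟩
        change (ofLex x).1 + (ofLex y).1 = 0
        rw [hx.1, hy.1, add_zero] }
  have hzS : zeta.support ⊆ S := by
    intro h hh
    have : h = toLex ((0 : ℝ), (-1 : ℤ)) := by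
      by_contra h'
      exact hh (coeff_single_of_ne h')
    rw [this]
    exact ⟨rfl, by norm_num⟩
  have key : (Polynomial.aeval zeta P).support ⊆ S := by
    intro h hh
    rw [Polynomial.aeval_eq_sum_range, mem_support, coeff_sum] at hh
    obtain ⟨i, -, hi⟩ := Finset.exists_ne_zero_of_sum_ne_zero hh
    refine support_pow_mem S hzS i (fun h0 => hi ?_)
    simp [h0]
  obtain ⟨i, hi, j, hj, rfl⟩ := support_mul_subset hg
  have hj' : j = toLex (a, (0 : ℤ)) := by
    by_contra h
    exact hj (coeff_single_of_ne h)
  subst hj'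
  refine ⟨?_, ?_⟩
  · change (ofLex i).1 + a = a
    rw [(key hi).1, zero_add]
  · change (ofLex i).2 + 0 ≤ 0
    rw [add_zero]
    exact (key hi).2

lemma zeta_pow (k : ℕ) : zeta ^ k = mono 0 (-k) := by
  rw [zeta_eq_inv, inv_pow, ← zpow_natCast, ← zpow_neg, mono_zpow]

/-- If all powers of `ζ` in `η` are nonnegative, then the block of `η` at `e^{-aζ}` is a polynomial
in `ζ`. -/
lemma exists_polynomial_slice (η : ExpTransseries) (hη : ∀ g ∈ η.support, (ofLex g).2 ≤ 0)
    (a : ℝ) : ∃ P : Polynomial ℂ, ∀ g : ℝ ×ₗ ℤ,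
      (Polynomial.aeval zeta P * mono a 0).coeff g = if (ofLex g).1 = a then η.coeff g else 0 := by
  have hK : {k : ℕ | η.coeff (toLex (a, -(k : ℤ))) ≠ 0}.Finite := by
    -- Infinitely many powers `ζ^k` in one block, listed with `k` increasing, would form a strictly
    -- decreasing sequence in a well-ordered support.
    by_contra hinf
    obtain ⟨m, n, hmn, hle⟩ := η.isPWO_support
      (fun n => ⟨toLex (a, -(Nat.nth (fun k : ℕ => η.coeff (toLex (a, -(k : ℤ))) ≠ 0) n : ℤ)),
        Nat.nth_mem_of_infinite hinf n⟩)
    have h1 := Nat.nth_strictMono hinf hmn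
    have h2 := Prod.Lex.toLex_le_toLex.1 hle
    rcases h2 with h2 | ⟨-, h2⟩
    · exact lt_irrefl _ h2
    · dsimp only at h2
      omega
  refine ⟨∑ k ∈ hK.toFinset, Polynomial.monomial k (η.coeff (toLex (a, -(k : ℤ)))), fun g => ?_⟩
  have hterm : ∀ k : ℕ, Polynomial.aeval zeta (Polynomial.monomial k
      (η.coeff (toLex (a, -(k : ℤ))))) * mono a 0 =
        single (toLex (a, -(k : ℤ))) (η.coeff (toLex (a, -(k : ℤ)))) := by
    intro k
    rw [Polynomial.aeval_monomial, zeta_pow, mul_assoc, mono_mul, zero_add, add_zero,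
      ← Algebra.smul_def, mono]
    ext g
    by_cases h : g = toLex (a, -(k : ℤ))
    · simp [h]
    · simp [coeff_single_of_ne h]
  rw [map_sum, Finset.sum_mul, coeff_sum, Finset.sum_congr rfl fun k _ => by rw [hterm k]]
  by_cases h : η.coeff g ≠ 0 ∧ (ofLex g).1 = a
  · obtain ⟨k, hk⟩ := Int.eq_ofNat_of_zero_le (neg_nonneg.2 (hη g h.1))
    have hg : g = toLex (a, -(k : ℤ)) := by
      rw [← h.2, ← hk, neg_neg]
      rfl
    rw [if_pos h.2, Finset.sum_eq_single k]
    · rw [← hg, coeff_single_same]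
    · intro j _ hj
      refine coeff_single_of_ne fun h' => hj ?_
      have := congrArg (fun x => (ofLex x).2) (hg.symm.trans h')
      simpa using this.symm
    · intro hk'
      rw [← hg]
      exact absurd (hK.mem_toFinset.2 (by rw [Set.mem_ofPred_eq, ← hg]; exact h.1)) hk'
  · have hr : (if (ofLex g).1 = a then η.coeff g else 0) = 0 := by
      by_cases h1 : (ofLex g).1 = a
      · rw [if_pos h1]
        by_contra h2
        exact h ⟨h2, h1⟩
      · exact if_neg h1
    rw [hr]
    refine Finset.sum_eq_zero fun k hk => coeff_single_of_ne fun h' => h ?_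
    rw [h']
    exact ⟨hK.mem_toFinset.1 hk, rfl⟩

/-- The exponents enumerate the whole semigroup, so some polynomials may be zero. The blocks
partition the support of `η`, whence summability. -/
lemma isDulacSeries_zeta_add {F : Finset ℝ} (hF : ∀ x ∈ F, 0 < x) (hne : F.Nonempty)
    {η : ExpTransseries} (hη : ∀ g ∈ η.support, (ofLex g).2 ≤ 0)
    (hηF : ∀ g ∈ η.support, (ofLex g).1 ∈ AddSubsemigroup.closure (F : Set ℝ)) :
    IsDulacSeries 1 0 (zeta + η) := by
  obtain ⟨a, hmono, htend, hrange⟩ := exists_enumeration_closure hF hne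
  have hmem : ∀ i, a i ∈ AddSubsemigroup.closure (F : Set ℝ) := fun i =>
    hrange.subset ⟨i, rfl⟩
  choose P hP using fun i => exists_polynomial_slice η hη (a i)
  let s : SummableFamily (ℝ ×ₗ ℤ) ℂ ℕ :=
    { toFun := fun i => Polynomial.aeval zeta (P i) * mono (a i) 0
      isPWO_iUnion_support' := η.isPWO_support.mono (Set.iUnion_subset fun i g hg h => hg (by
        rw [hP, h, ite_self]))
      finite_co_support' := fun g => Set.Subsingleton.finite fun i hi j hj => by
        have key : ∀ k, (Polynomial.aeval zeta (P k) * mono (a k) 0).coeff g ≠ 0 →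
            (ofLex g).1 = a k := fun k hk => by
          by_contra h
          exact hk (by rw [hP, if_neg h])
        exact hmono.injective ((key i hi).symm.trans (key j hj)) }
  refine ⟨one_pos, a, P, s, hmono, fun i => ?_, htend, ⟨F, hF, hmem⟩, fun i => rfl, ?_⟩
  · have : ∀ x ∈ AddSubsemigroup.closure (F : Set ℝ), 0 < x := by
      intro x hx
      induction hx using AddSubsemigroup.closure_induction with
      | mem x hx => exact hF x hx
      | add x y _ _ hx hy => exact add_pos hx hy
    exact this _ (hmem i)
  · rw [Complex.ofReal_one, map_one, one_mul, map_zero, add_zero]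
    congr 1
    ext g
    rw [SummableFamily.coeff_hsum]
    change _ = ∑ᶠ i, (Polynomial.aeval zeta (P i) * mono (a i) 0).coeff g
    simp only [hP]
    by_cases hg : η.coeff g = 0
    · simp [hg]
    · obtain ⟨i, hi⟩ := hrange.superset (hηF g hg)
      rw [finsum_eq_single _ i fun j hj => if_neg fun h => hj (hmono.injective (h.symm.trans hi.symm)),
        if_pos hi.symm]

/-! ### Assembly of the solution -/

lemma constTerm_of_eq {β : ℂ} {ε : ExpTransseries} (hε : 0 < ε.orderTop) :
    constTerm (zeta + C β + ε) = β ∧ tail (zeta + C β + ε) = ε := by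
  have h0 : ε.coeff 0 = 0 := by
    by_contra h
    exact lt_irrefl _ (pos_of_mem_support hε (g := 0) h)
  have hzeta : zeta.coeff 0 = 0 := coeff_single_of_ne
    (fun h => by simpa using congrArg (fun x => (ofLex x).2) h)
  have hc : constTerm (zeta + C β + ε) = β := by simp [constTerm, h0, hzeta]
  refine ⟨hc, ?_⟩
  rw [tail, hc]
  ring

lemma IsDulacSeries.exists_tail {β : ℂ} {f : ExpTransseries} (hf : IsDulacSeries 1 β f) :
    constTerm f = β ∧ f = zeta + C β + tail f ∧
    ∃ F : Finset ℝ, (∀ x ∈ F, 0 < x) ∧ F.Nonempty ∧ ∀ g ∈ (tail f).support,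
      (ofLex g).1 ∈ AddSubsemigroup.closure (F : Set ℝ) ∧ 0 < (ofLex g).1 ∧ (ofLex g).2 ≤ 0 := by
  obtain ⟨-, a, P, s, -, ha, -, ⟨F, hF, haF⟩, hs, rfl⟩ := hf
  have hsupp : ∀ g ∈ s.hsum.support, (ofLex g).1 ∈ AddSubsemigroup.closure (F : Set ℝ) ∧
      0 < (ofLex g).1 ∧ (ofLex g).2 ≤ 0 := by
    intro g hg
    obtain ⟨i, hi⟩ := Set.mem_iUnion.1 (SummableFamily.support_hsum_subset hg)
    rw [hs] at hi
    obtain ⟨h1, h2⟩ := support_aeval_mul_mono hi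
    rw [h1]
    exact ⟨haF i, ha i, h2⟩
  have hpos : 0 < s.hsum.orderTop := pos_orderTop fun g hg => zero_lt_of_fst_pos (hsupp g hg).2.1
  obtain ⟨hc, ht⟩ := constTerm_of_eq (β := β) hpos
  rw [Complex.ofReal_one, map_one, one_mul, ht]
  refine ⟨hc, rfl, F, hF, ?_, hsupp⟩
  -- The semigroup generated by the empty set is empty, yet it would contain `a 0`.
  by_contra h
  rw [Finset.not_nonempty_iff_eq_empty] at h
  have := haF 0
  rw [h, Finset.coe_empty, AddSubsemigroup.closure_empty] at this
  exact this

/-- The monomials `e^{-νζ} ζ^k` with `ν` in the monoid generated by `F` and `k ≥ 0`. -/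
def dulacMonoid (F : Finset ℝ) : AddSubmonoid (ℝ ×ₗ ℤ) where
  carrier := {g | (ofLex g).1 ∈ AddSubmonoid.closure (F : Set ℝ) ∧ (ofLex g).2 ≤ 0}
  zero_mem' := ⟨zero_mem _, le_rfl⟩
  add_mem' hx hy := ⟨add_mem hx.1 hy.1, add_nonpos hx.2 hy.2⟩

lemma IsDulacSeries.exists_solution {β : ℂ} (hβ : 0 < β.re) {f : ExpTransseries}
    (hf : IsDulacSeries 1 β f) :
    ∃ φ : ExpTransseries, IsParabolic φ ∧
      comp φ f hf.isNearTranslation = φ + C β ∧ IsDulacSeries 1 0 φ ∧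
      (HasRealCoeffs f → HasRealCoeffs φ) := by
  obtain ⟨hc, hfe, F, hF, hne, hsupp⟩ := hf.exists_tail
  have hN := hf.isNearTranslation
  have hβ' : 0 < (constTerm f).re := by rwa [hc]
  obtain ⟨η, hηpos, hη⟩ := exists_sub_comp_eq hN hβ' fun g hg => (hsupp g hg).2.1
  have htM : (tail f).support ⊆ dulacMonoid F := fun g hg =>
    ⟨closure_le_addSubmonoid_closure (hsupp g hg).1, (hsupp g hg).2.2⟩
  have hfM : f.support ⊆ dulacMonoid F := by
    rw [hfe]
    intro g hg
    rcases support_add_subset _ _ hg with hg | hg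
    · rcases support_add_subset _ _ hg with hg | hg
      · have : g = toLex ((0 : ℝ), (-1 : ℤ)) := by
          by_contra h
          exact hg (coeff_single_of_ne h)
        rw [this]
        exact ⟨zero_mem _, by norm_num⟩
      · have : g = 0 := by
          by_contra h
          exact hg (coeff_single_of_ne h)
        rw [this]
        exact zero_mem _
    · exact htM hg
  have hηM : η.support ⊆ dulacMonoid F := support_subset_of_sub_comp hN hβ' hη hηpos
    (fun g hg => hg.2) (fun g hg => ⟨hg.1, le_rfl⟩) hfM htM htM
  refine ⟨zeta + η, ?_, ?_, ?_, fun hr => ?_⟩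
  · rw [IsParabolic, add_sub_cancel_left]
    exact pos_orderTop fun g hg => zero_lt_of_fst_pos (hηpos g hg)
  · rw [comp_add, comp_zeta]
    linear_combination hfe - hη
  · exact isDulacSeries_zeta_add hF hne (fun g hg => (hηM hg).2) fun g hg =>
      mem_closure_of_mem_closure_of_ne_zero (hηM hg).1 (hηpos g hg).ne'
  · exact (hasRealCoeffs_single _ Complex.one_im).add
      (hasRealCoeffs_of_sub_comp hN hβ' hη hηpos (fun g hg => (hηM hg).2) hr hr.tail)

lemma parabolic_solution_unique {f φ ψ : ExpTransseries} {β : ℂ} (hf : IsNearTranslation f)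
    (hβ : 0 < (constTerm f).re) (hφ : IsParabolic φ) (hψ : IsParabolic ψ)
    (hφf : comp φ f hf = φ + C β) (hψf : comp ψ f hf = ψ + C β) : φ = ψ := by
  rw [← sub_eq_zero]
  refine eq_zero_of_comp_eq_self hf hβ ?_ ?_
  · have : φ - ψ = (φ - zeta) - (ψ - zeta) := by ring
    rw [this]
    exact (lt_min hφ hψ).trans_le min_orderTop_le_orderTop_sub
  · rw [sub_eq_add_neg, comp_add, comp_neg, hφf, hψf]
    ring

end ExpTransseries

theorem mainTheorem4 (f : ExpTransseries) (β : ℂ) (hβ : 0 < β.re)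
    (hf : ExpTransseries.IsDulacSeries 1 β f) :
    (∃! φ : ExpTransseries, ExpTransseries.IsParabolic φ ∧
        ExpTransseries.comp φ f hf.isNearTranslation = φ + HahnSeries.C β) ∧
      ∀ φ : ExpTransseries, ExpTransseries.IsParabolic φ →
        ExpTransseries.comp φ f hf.isNearTranslation = φ + HahnSeries.C β →
        ExpTransseries.IsDulacSeries 1 0 φ ∧
          (ExpTransseries.HasRealCoeffs f → ExpTransseries.HasRealCoeffs φ) := by
  have hβ' : 0 < (ExpTransseries.constTerm f).re := by rwa [hf.exists_tail.1]
  obtain ⟨φ, hφ, hφf, hD, hR⟩ := hf.exists_solution hβ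
  have huniq : ∀ ψ : ExpTransseries, ExpTransseries.IsParabolic ψ →
      ExpTransseries.comp ψ f hf.isNearTranslation = ψ + HahnSeries.C β → ψ = φ :=
    fun ψ hψ hψf => ExpTransseries.parabolic_solution_unique hf.isNearTranslation hβ' hψ hφ hψf hφf
  refine ⟨⟨φ, ⟨hφ, hφf⟩, fun ψ hψ => huniq ψ hψ.1 hψ.2⟩, fun ψ hψ hψf => ?_⟩
  rw [huniq ψ hψ hψf]
  exact ⟨hD, hR⟩
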